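/- Let $H$ and $H'$ be Hermitian operators on a finite-dimensional complex Hilbert space of dimension $d$, let $U$ be a unitary operator on it, and let $\beta$ be a nonzero real number. Let $$\Omega = U^\dagger H' U - H$$ be the Heisenberg operator of work, and let $$\Upsilon_\tau = -\beta^{-1}\ln\!\left(e^{\beta H/2}\, e^{-\beta U^\dagger H' U}\, e^{\beta H/2}\right)$$ be the work operator associated with the thermal state $\tau = e^{-\beta H}/\operatorname{tr} e^{-\beta H}$. Let $\Gamma_1 \ge \dots \ge \Gamma_d$ and $\Omega_1 \ge \dots \ge \Omega_d$ be the eigenvalues, counted with multiplicity and ordered decreasingly, of $\Upsilon_\tau$ and of $\Omega$. Then the spectrum of $\Upsilon_\tau$ majorizes that of $\Omega$, $\mathrm{Spec}(\Upsilon_\tau)^{\downarrow} \succ \mathrm{Spec}(\Omega)^{\downarrow}$, that is, $$\sum_{m=1}^k \Omega_m \le \sum_{m=1}^k \Gamma_m \quad (k = 1, \dots, d-1), \qquad \sum_{m=1}^d \Omega_m = \sum_{m=1}^d \Gamma_m .$$ -/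

import Mathlib

open scoped Matrix

namespace QWork

/-- The decreasing rearrangement `x↓` of a finite tuple of reals. -/
noncomputable def decr {d : ℕ} (x : Fin d → ℝ) : Fin d → ℝ :=
  fun i => x (Tuple.sort x i.rev)

theorem decr_antitone {d : ℕ} (x : Fin d → ℝ) : Antitone (decr x) := by
  intro i j hij
  exact Tuple.monotone_sort x (Fin.rev_le_rev.mpr hij)

/-- Majorization `x ≻ y`: for every `k`, the sum of the `k` largest entries of `y` is at most the
sum of the `k` largest entries of `x`, and the sums of all entries agree. -/
def Majorizes {d : ℕ} (x y : Fin d → ℝ) : Prop :=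
  (∀ k : ℕ, k ≤ d →
    ∑ i : Fin d with i.val < k, decr y i ≤ ∑ i : Fin d with i.val < k, decr x i) ∧
  ∑ i : Fin d, x i = ∑ i : Fin d, y i

variable {n : Type*} [Fintype n] [DecidableEq n]

/-- `Spec(A)↓`: the eigenvalues of a Hermitian matrix, with multiplicity, in decreasing order. -/
noncomputable def spec (A : Matrix n n ℂ) (hA : A.IsHermitian) : Fin (Fintype.card n) → ℝ :=
  hA.eigenvalues₀

/-- The Heisenberg-picture final Hamiltonian `U† H' U`. -/
def evolved (H' : Matrix n n ℂ) (U : Matrix.unitaryGroup n ℂ) : Matrix n n ℂ :=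
  (U : Matrix n n ℂ)ᴴ * H' * (U : Matrix n n ℂ)

/-- The Heisenberg operator of work `Ω = U† H' U - H`. -/
def heisenbergWork (H H' : Matrix n n ℂ) (U : Matrix.unitaryGroup n ℂ) : Matrix n n ℂ :=
  evolved H' U - H

/-- The positive definite operator `e^{βH/2} e^{-β U† H' U} e^{βH/2}`. -/
noncomputable def boltzmannProduct (β : ℝ) (H H' : Matrix n n ℂ) (U : Matrix.unitaryGroup n ℂ) :
    Matrix n n ℂ :=
  NormedSpace.exp ((β / 2) • H) * NormedSpace.exp ((-β) • evolved H' U) *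
    NormedSpace.exp ((β / 2) • H)

/-- The work operator `Υ = -β⁻¹ ln (e^{βH/2} e^{-β U† H' U} e^{βH/2})`. The logarithm is the
continuous functional calculus of `Real.log`, applied to a positive definite matrix. -/
noncomputable def upsilon (β : ℝ) (H H' : Matrix n n ℂ) (U : Matrix.unitaryGroup n ℂ) :
    Matrix n n ℂ :=
  (-β⁻¹) • cfc Real.log (boltzmannProduct β H H' U)

theorem evolved_isHermitian {H' : Matrix n n ℂ} (hH' : H'.IsHermitian)
    (U : Matrix.unitaryGroup n ℂ) : (evolved H' U).IsHermitian :=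
  Matrix.isHermitian_conjTranspose_mul_mul _ hH'

theorem heisenbergWork_isHermitian {H H' : Matrix n n ℂ} (hH : H.IsHermitian)
    (hH' : H'.IsHermitian) (U : Matrix.unitaryGroup n ℂ) :
    (heisenbergWork H H' U).IsHermitian :=
  (evolved_isHermitian hH' U).sub hH

theorem upsilon_isHermitian (β : ℝ) (H H' : Matrix n n ℂ) (U : Matrix.unitaryGroup n ℂ) :
    (upsilon β H H' U).IsHermitian := by
  have h : IsSelfAdjoint (cfc Real.log (boltzmannProduct β H H' U)) := cfc_predicate _ _
  exact (IsSelfAdjoint.all (-β⁻¹)).smul h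

end QWork

/-!
Put `s = |β|`, `h = -(s / 2) H` and `b = s U† H' U`. Then `s Ω = h + b + h`, while
`exp (s Υ) = exp h * exp b * exp h` whatever the sign of `β` (`exp_abs_smul_upsilon`), so the claim
is that the spectrum of `log (exp h * exp b * exp h)` majorizes that of `h + b + h`.

Equality of the total sums is equality of traces, which comes from taking determinants
(`re_trace_of_exp_eq`).

For the largest eigenvalue, the inequality says that `exp h * exp b * exp h ≤ exp r` implies
`h + b + h ≤ r`. This is operator monotonicity of the logarithm: conjugation by `exp (-h)` gives
`exp b ≤ exp (r - 2 h)`, hence `b ≤ r - 2 h`.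

The sum of the `k` largest eigenvalues reduces to this case without exterior powers. Let `μ` be the
`k`-th eigenvalue of `Υ`, let `w` be `s Υ` with its eigenvalues cut off at `s μ`, and define `b'` by
`exp w = exp h * exp b' * exp h`. By operator monotonicity `b' ≤ b` and `h + b' + h ≤ s μ`
(`exists_le_of_exp_le`), so `s Ω ≤ s μ + (b - b')` with `b - b' ≥ 0`. Therefore the `k` largest
eigenvalues of `s Ω` sum to at most `k s μ + tr (b - b')` (`sum_spec_le_of_le_add`). By the trace
identity `tr (b - b') = tr (s Υ - w)`, which is the sum of `s (Γ_m - μ)` over `m ≤ k`, and the bound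
becomes `s (Γ_1 + ⋯ + Γ_k)` (`sum_spec_le`).
-/

namespace QWork

/-! ### Exponentials and logarithms in a C⋆-algebra -/

section CStarAlgebra

variable {A : Type*} [CStarAlgebra A]

theorem exp_mul_exp_neg (a : A) : NormedSpace.exp a * NormedSpace.exp (-a) = 1 := by
  let := NormedAlgebra.restrictScalars ℚ ℝ A
  rw [← NormedSpace.exp_add_of_commute (Commute.refl a).neg_right, add_neg_cancel,
    NormedSpace.exp_zero]

theorem exp_neg_mul_exp (a : A) : NormedSpace.exp (-a) * NormedSpace.exp a = 1 := by
  simpa using exp_mul_exp_neg (-a)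

theorem exp_neg_conj_exp_conj (h x : A) :
    NormedSpace.exp (-h) * (NormedSpace.exp h * x * NormedSpace.exp h) * NormedSpace.exp (-h) =
      x := by
  calc _ = (NormedSpace.exp (-h) * NormedSpace.exp h) * x *
        (NormedSpace.exp h * NormedSpace.exp (-h)) := by simp only [mul_assoc]
    _ = x := by rw [exp_mul_exp_neg, exp_neg_mul_exp, one_mul, mul_one]

variable [PartialOrder A] [StarOrderedRing A]

theorem isStrictlyPositive_exp {a : A} (ha : IsSelfAdjoint a) :
    IsStrictlyPositive (NormedSpace.exp a) :=
  IsStrictlyPositive.iff_of_unital.mpr ⟨ha.exp_nonneg,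
    ⟨⟨_, _, exp_mul_exp_neg a, exp_neg_mul_exp a⟩, rfl⟩⟩

theorem isStrictlyPositive_exp_conj {h x : A} (hh : IsSelfAdjoint h)
    (hx : IsStrictlyPositive x) :
    IsStrictlyPositive (NormedSpace.exp h * x * NormedSpace.exp h) :=
  have hu := (isStrictlyPositive_exp hh).isUnit
  IsStrictlyPositive.iff_of_unital.mpr
    ⟨hh.exp.conjugate_nonneg hx.nonneg, (hu.mul hx.isUnit).mul hu⟩

/-- If `exp w` lies below both `exp h * exp b * exp h` and the scalar `exp r`, then the self-adjoint
`b'` defined by `exp w = exp h * exp b' * exp h` lies below `b`, and `h + b' + h` lies below `r`.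
Both bounds follow by conjugating with `exp (-h)` and applying operator monotonicity of the
logarithm; in the second one the conjugated scalar is `exp (r - 2 h)`. -/
theorem exists_le_of_exp_le {h b w : A} {r : ℝ} (hh : IsSelfAdjoint h) (hb : IsSelfAdjoint b)
    (hw : IsSelfAdjoint w)
    (hwb : NormedSpace.exp w ≤ NormedSpace.exp h * NormedSpace.exp b * NormedSpace.exp h)
    (hwr : NormedSpace.exp w ≤ NormedSpace.exp (algebraMap ℝ A r)) :
    ∃ b' : A, IsSelfAdjoint b' ∧ b' ≤ b ∧ h + b' + h ≤ algebraMap ℝ A r ∧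
      NormedSpace.exp w = NormedSpace.exp h * NormedSpace.exp b' * NormedSpace.exp h := by
  let := NormedAlgebra.restrictScalars ℚ ℝ A
  set x := NormedSpace.exp (-h) * NormedSpace.exp w * NormedSpace.exp (-h)
  have hxpos : IsStrictlyPositive x :=
    isStrictlyPositive_exp_conj hh.neg (isStrictlyPositive_exp hw)
  refine ⟨CFC.log x, .log, ?_, ?_, ?_⟩
  · rw [← CFC.log_exp b hb]
    refine CFC.log_le_log ?_ hxpos
    rw [← exp_neg_conj_exp_conj h (NormedSpace.exp b)]
    exact hh.neg.exp.conjugate_le_conjugate hwb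
  · have key : CFC.log x ≤ -h + algebraMap ℝ A r + -h := by
      rw [← CFC.log_exp (-h + algebraMap ℝ A r + -h)
        ((hh.neg.add (IsSelfAdjoint.algebraMap A (.all r))).add hh.neg)]
      refine CFC.log_le_log ?_ hxpos
      have hc : Commute (-h) (algebraMap ℝ A r) := (Algebra.commutes r (-h)).symm
      rw [NormedSpace.exp_add_of_commute (((Commute.refl (-h))).add_left hc.symm),
        NormedSpace.exp_add_of_commute hc]
      exact hh.neg.exp.conjugate_le_conjugate hwr
    calc h + CFC.log x + h ≤ h + (-h + algebraMap ℝ A r + -h) + h := by gcongr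
      _ = algebraMap ℝ A r := by abel
  · have := exp_neg_conj_exp_conj (-h) (NormedSpace.exp w)
    rw [neg_neg] at this
    rw [CFC.exp_log x hxpos, this]

end CStarAlgebra

/-! ### Eigenvalue sums of Hermitian matrices -/

section Matrix

open scoped Matrix.Norms.L2Operator MatrixOrder ComplexOrder

variable {n : Type*} [Fintype n] [DecidableEq n]

theorem spec_antitone {X : Matrix n n ℂ} (hX : X.IsHermitian) : Antitone (spec X hX) :=
  hX.eigenvalues₀_antitone

theorem sum_eigenvalues_eq_sum_spec {X : Matrix n n ℂ} (hX : X.IsHermitian) (f : ℝ → ℝ) :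
    ∑ i, f (hX.eigenvalues i) = ∑ j, f (spec X hX j) :=
  Equiv.sum_comp (Fintype.equivOfCardEq (Fintype.card_fin (Fintype.card n))).symm
    (fun j => f (spec X hX j))

theorem re_trace_eq_sum_spec {X : Matrix n n ℂ} (hX : X.IsHermitian) :
    X.trace.re = ∑ j, spec X hX j := by
  rw [hX.trace_eq_sum_eigenvalues, Complex.re_sum]
  exact sum_eigenvalues_eq_sum_spec hX id

theorem re_trace_cfc {X : Matrix n n ℂ} (hX : X.IsHermitian) (f : ℝ → ℝ) :
    (cfc f X).trace.re = ∑ j, f (spec X hX j) := by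
  rw [← sum_eigenvalues_eq_sum_spec, hX.cfc_eq, Matrix.IsHermitian.cfc,
    Unitary.conjStarAlgAut_apply, Matrix.trace_mul_cycle, Unitary.coe_star_mul_self, one_mul,
    Matrix.trace_diagonal, Complex.re_sum]
  rfl

theorem det_exp {X : Matrix n n ℂ} (hX : X.IsHermitian) :
    (NormedSpace.exp X).det = (Real.exp X.trace.re : ℂ) := by
  rw [← CFC.real_exp_eq_normedSpace_exp hX.isSelfAdjoint, hX.cfc_eq, Matrix.IsHermitian.cfc,
    Unitary.conjStarAlgAut_apply, mul_assoc, Matrix.det_mul_comm, mul_assoc,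
    Unitary.coe_star_mul_self, mul_one, Matrix.det_diagonal, hX.trace_eq_sum_eigenvalues,
    Complex.re_sum, Real.exp_sum]
  simp

/-- The logarithm of `exp h * exp b * exp h` has the same trace as `h + b + h`: compare
determinants. -/
theorem re_trace_of_exp_eq {y h b : Matrix n n ℂ} (hy : y.IsHermitian) (hh : h.IsHermitian)
    (hb : b.IsHermitian)
    (heq : NormedSpace.exp y = NormedSpace.exp h * NormedSpace.exp b * NormedSpace.exp h) :
    y.trace.re = (h + b + h).trace.re := by
  have := congrArg Matrix.det heq
  rw [Matrix.det_mul, Matrix.det_mul, det_exp hy, det_exp hh, det_exp hb] at this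
  norm_cast at this
  rw [← Real.exp_add, ← Real.exp_add, Real.exp_eq_exp] at this
  simpa [Matrix.trace_add] using this

/-- A Ky Fan type bound: if `s • X ≤ r + D` with `D ≥ 0`, then any partial sum of eigenvalues of
`s • X` over an index set `T` is at most `r * #T + tr D`. In an eigenbasis of `X` this holds entry by
entry on the diagonal, and the diagonal entries of `D` left out of `T` are nonnegative. -/
theorem sum_spec_le_of_le_add {X D : Matrix n n ℂ} (hX : X.IsHermitian) (hD : 0 ≤ D) {s r : ℝ}
    (hXD : s • X ≤ algebraMap ℝ _ r + D) (T : Finset (Fin (Fintype.card n))) :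
    s * ∑ j ∈ T, spec X hX j ≤ ∑ _j ∈ T, r + D.trace.re := by
  set V : Matrix n n ℂ := (hX.eigenvectorUnitary : Matrix n n ℂ)
  have hVV : V * star V = 1 := Unitary.coe_mul_star_self _
  have hVV' : star V * V = 1 := Unitary.coe_star_mul_self _
  set e : n ≃ Fin (Fintype.card n) :=
    (Fintype.equivOfCardEq (Fintype.card_fin (Fintype.card n))).symm
  have hdiag : star V * X * V = Matrix.diagonal (RCLike.ofReal ∘ hX.eigenvalues) := by
    rw [← hX.conjStarAlgAut_star_eigenvectorUnitary, Unitary.conjStarAlgAut_star_apply]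
  have hE : ∀ i, 0 ≤ ((star V * D * V) i i).re := fun i =>
    (Complex.le_def.mp (Matrix.nonneg_iff_posSemidef.mp
      (star_left_conjugate_nonneg hD V)).diag_nonneg).1
  have hle : ∀ i, s * hX.eigenvalues i ≤ r + ((star V * D * V) i i).re := by
    intro i
    have h1 := star_left_conjugate_le_conjugate hXD V
    have h2 := (Complex.le_def.mp
      (Matrix.PosSemidef.diag_nonneg (Matrix.le_iff.mp h1) (i := i))).1
    have h3 : star V * (s • X) * V = s • Matrix.diagonal (RCLike.ofReal ∘ hX.eigenvalues) := by
      rw [← hdiag]; simp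
    have h4 : star V * (algebraMap ℝ _ r + D) * V = algebraMap ℝ _ r + star V * D * V := by
      rw [mul_add, add_mul, ← Algebra.commutes, mul_assoc, hVV', mul_one]
    rw [h3, h4] at h2
    simpa [Matrix.algebraMap_matrix_apply] using h2
  have htr : D.trace.re = ∑ j, ((star V * D * V) (e.symm j) (e.symm j)).re := by
    rw [Equiv.sum_comp e.symm (fun i => ((star V * D * V) i i).re), ← Complex.re_sum]
    change _ = (Matrix.trace (star V * D * V)).re
    rw [Matrix.trace_mul_cycle, hVV, one_mul]
  calc s * ∑ j ∈ T, spec X hX j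
      = ∑ j ∈ T, s * hX.eigenvalues (e.symm j) := by
        rw [Finset.mul_sum]
        refine Finset.sum_congr rfl fun j _ => ?_
        simp [Matrix.IsHermitian.eigenvalues, e, spec]
    _ ≤ ∑ j ∈ T, (r + ((star V * D * V) (e.symm j) (e.symm j)).re) :=
        Finset.sum_le_sum fun j _ => hle _
    _ ≤ ∑ _j ∈ T, r + D.trace.re := by
        rw [Finset.sum_add_distrib, htr]
        gcongr
        · exact fun _ _ _ => hE _
        · exact Finset.subset_univ T

/-- If `exp (s • Y) = exp h * exp b * exp h` with `s • X = h + b + h` and `s > 0`, then the sum of the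
`k` largest eigenvalues of `X` is at most that of `Y`. -/
theorem sum_spec_le {X Y h b : Matrix n n ℂ} (hX : X.IsHermitian) (hY : Y.IsHermitian)
    (hh : h.IsHermitian) (hb : b.IsHermitian) {s : ℝ} (hs : 0 < s) (hsX : s • X = h + b + h)
    (hexp : NormedSpace.exp (s • Y) = NormedSpace.exp h * NormedSpace.exp b * NormedSpace.exp h)
    (k : ℕ) (hk : k ≤ Fintype.card n) :
    ∑ j : Fin (Fintype.card n) with j.val < k, spec X hX j ≤
      ∑ j : Fin (Fintype.card n) with j.val < k, spec Y hY j := by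
  rcases k.eq_zero_or_pos with rfl | hk0
  · simp
  set μ := spec Y hY ⟨k - 1, by omega⟩
  have hYs : IsSelfAdjoint Y := hY
  -- `w` is `s • Y` with its eigenvalues cut off at `s * μ`; at most the `k` largest ones change.
  set w : Matrix n n ℂ := cfc (fun x => s * min x μ) Y with hw
  have hws : IsSelfAdjoint w := cfc_predicate _ _
  have hew : NormedSpace.exp w = cfc (fun x => Real.exp (s * min x μ)) Y := by
    rw [← CFC.real_exp_eq_normedSpace_exp hws, hw, ← cfc_comp' Real.exp _ Y]
  have hey : NormedSpace.exp (s • Y) = cfc (fun x => Real.exp (s * x)) Y := by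
    rw [← CFC.real_exp_eq_normedSpace_exp ((IsSelfAdjoint.all s).smul hYs),
      ← cfc_const_mul_id s Y, ← cfc_comp' Real.exp _ Y]
  have her : NormedSpace.exp (algebraMap ℝ (Matrix n n ℂ) (s * μ)) =
      algebraMap ℝ _ (Real.exp (s * μ)) := by
    rw [← CFC.real_exp_eq_normedSpace_exp (IsSelfAdjoint.algebraMap _ (.all _)), cfc_algebraMap]
  obtain ⟨b', hb's, hb'b, hb'r, hb'exp⟩ := exists_le_of_exp_le (r := s * μ) (w := w)
    hh.isSelfAdjoint hb.isSelfAdjoint hws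
    (by
      rw [← hexp, hew, hey]
      refine cfc_mono fun x _ => ?_
      gcongr
      exact min_le_left _ _)
    (by
      rw [hew, her]
      refine cfc_le_algebraMap _ _ _ fun x _ => ?_
      gcongr
      exact min_le_right _ _)
  -- Replacing `s • Y` by `w` costs exactly the trace of `b - b'`.
  have htD : (b - b').trace.re = ∑ j, (s * spec Y hY j - s * min (spec Y hY j) μ) := by
    have h1 := re_trace_of_exp_eq (((IsSelfAdjoint.all s).smul hYs) : (s • Y).IsHermitian) hh hb hexp
    have h2 := re_trace_of_exp_eq hws hh hb's hb'exp
    rw [← cfc_const_mul_id s Y, re_trace_cfc hY] at h1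
    rw [hw, re_trace_cfc hY] at h2
    rw [Finset.sum_sub_distrib, h1, h2]
    simp only [Matrix.trace_add, Matrix.trace_sub, Complex.add_re, Complex.sub_re]
    ring
  have hle : s • X ≤ algebraMap ℝ _ (s * μ) + (b - b') := by
    calc s • X = (h + b' + h) + (b - b') := by rw [hsX]; abel
      _ ≤ _ := by gcongr
  have hmain := sum_spec_le_of_le_add hX (sub_nonneg.mpr hb'b) hle
    (Finset.univ.filter fun j => j.val < k)
  have hclip : ∀ j, s * spec Y hY j - s * min (spec Y hY j) μ =
      if j.val < k then s * spec Y hY j - s * μ else 0 := by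
    intro j
    split_ifs with hj
    · rw [min_eq_right (spec_antitone hY (Fin.le_def.mpr (by simp; omega)))]
    · rw [min_eq_left (spec_antitone hY (Fin.le_def.mpr (by simp; omega))), sub_self]
  rw [htD, Finset.sum_congr rfl fun j _ => hclip j, ← Finset.sum_filter,
    Finset.sum_sub_distrib, add_sub_cancel, ← Finset.mul_sum] at hmain
  exact le_of_mul_le_mul_left hmain hs

end Matrix

/-! ### The work operator -/

theorem decr_eq_self {d : ℕ} {x : Fin d → ℝ} (hx : Antitone x) : decr x = x := by
  have h : x ∘ Fin.revPerm = x ∘ Tuple.sort x :=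
    Tuple.comp_sort_eq_comp_iff_monotone.mpr fun i j hij => hx (Fin.rev_le_rev.mpr hij)
  funext i
  simpa [decr] using (congrFun h i.rev).symm

/-- Multiplying by `|β|` rather than by `-β` makes both signs of `β` instances of the same identity:
for `β < 0` it is the definition of `Υ`, and for `β > 0` it is the inverse of that identity. -/
theorem exp_abs_smul_upsilon {n : Type*} [Fintype n] [DecidableEq n] {H H' : Matrix n n ℂ}
    (hH : H.IsHermitian) (hH' : H'.IsHermitian) (U : Matrix.unitaryGroup n ℂ) {β : ℝ}
    (hβ : β ≠ 0) :
    NormedSpace.exp (|β| • upsilon β H H' U) =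
      NormedSpace.exp ((-(|β| / 2)) • H) * NormedSpace.exp (|β| • evolved H' U) *
        NormedSpace.exp ((-(|β| / 2)) • H) := by
  open scoped Matrix.Norms.L2Operator MatrixOrder in
  have hpos : IsStrictlyPositive (boltzmannProduct β H H' U) :=
    isStrictlyPositive_exp_conj ((IsSelfAdjoint.all (β / 2)).smul hH.isSelfAdjoint)
      (isStrictlyPositive_exp
        ((IsSelfAdjoint.all (-β)).smul (evolved_isHermitian hH' U).isSelfAdjoint))
  have hlog : NormedSpace.exp (cfc Real.log (boltzmannProduct β H H' U)) =
      boltzmannProduct β H H' U := CFC.exp_log _ hpos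
  rcases hβ.lt_or_gt with hneg | hpos'
  · rw [upsilon, smul_smul, abs_of_neg hneg, neg_mul_neg, mul_inv_cancel₀ hβ, one_smul, hlog,
      boltzmannProduct, ← neg_div, neg_neg]
  · rw [upsilon, smul_smul, abs_of_pos hpos', mul_neg, mul_inv_cancel₀ hβ, neg_one_smul]
    refine left_inv_eq_right_inv (a := boltzmannProduct β H H' U) ?_ ?_
    · open scoped Matrix.Norms.L2Operator in
      simpa only [hlog] using exp_neg_mul_exp (cfc Real.log (boltzmannProduct β H H' U))
    · rw [boltzmannProduct, neg_smul, neg_smul]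
      set x := (β / 2) • H
      set y := β • evolved H' U
      open scoped Matrix.Norms.L2Operator in
      calc NormedSpace.exp x * NormedSpace.exp (-y) * NormedSpace.exp x *
            (NormedSpace.exp (-x) * NormedSpace.exp y * NormedSpace.exp (-x))
          = NormedSpace.exp x * (NormedSpace.exp (-y) *
            (NormedSpace.exp x * NormedSpace.exp (-x)) * NormedSpace.exp y) *
              NormedSpace.exp (-x) := by simp only [mul_assoc]
        _ = 1 := by
          rw [exp_mul_exp_neg, mul_one, exp_neg_mul_exp, mul_one, exp_mul_exp_neg]

end QWork

theorem propositionE2 {n : Type*} [Fintype n] [DecidableEq n]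
    (H H' : Matrix n n ℂ) (hH : H.IsHermitian) (hH' : H'.IsHermitian)
    (U : Matrix.unitaryGroup n ℂ) (β : ℝ) (hβ : β ≠ 0) :
    QWork.Majorizes
      (QWork.spec (QWork.upsilon β H H' U) (QWork.upsilon_isHermitian β H H' U))
      (QWork.spec (QWork.heisenbergWork H H' U)
        (QWork.heisenbergWork_isHermitian hH hH' U)) := by
  have hs : 0 < |β| := abs_pos.mpr hβ
  have hΥ := QWork.upsilon_isHermitian β H H' U
  have hΩ := QWork.heisenbergWork_isHermitian hH hH' U
  have hh : ((-(|β| / 2)) • H).IsHermitian := (IsSelfAdjoint.all _).smul hH.isSelfAdjoint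
  have hb : (|β| • QWork.evolved H' U).IsHermitian :=
    (IsSelfAdjoint.all _).smul (QWork.evolved_isHermitian hH' U).isSelfAdjoint
  have hexp := QWork.exp_abs_smul_upsilon hH hH' U hβ
  have hsum : |β| • QWork.heisenbergWork H H' U =
      (-(|β| / 2)) • H + |β| • QWork.evolved H' U + (-(|β| / 2)) • H := by
    rw [QWork.heisenbergWork]
    module
  refine ⟨fun k hk => ?_, ?_⟩
  · rw [QWork.decr_eq_self (QWork.spec_antitone hΩ), QWork.decr_eq_self (QWork.spec_antitone hΥ)]
    exact QWork.sum_spec_le hΩ hΥ hh hb hs hsum hexp k hk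
  · have htr := QWork.re_trace_of_exp_eq
      (((IsSelfAdjoint.all |β|).smul hΥ.isSelfAdjoint) : (|β| • QWork.upsilon β H H' U).IsHermitian) hh hb hexp
    rw [← hsum, Matrix.trace_smul, Matrix.trace_smul, Complex.smul_re, Complex.smul_re,
      QWork.re_trace_eq_sum_spec hΥ, QWork.re_trace_eq_sum_spec hΩ] at htr
    exact mul_left_cancel₀ hs.ne' htr
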